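/- Write $\mathbb N=\{1,2,3,\dots\}$ and let $S$ be a dense subsemigroup of $((0,\infty),+)$. Let $0^+(S)$ be the set of ultrafilters $p$ on the set $S$ such that $(0,\varepsilon)\cap S\in p$ for every $\varepsilon>0$; it is a semigroup under the operation determined by $$A\in p+q\iff\{x\in S:\{z\in S:x+z\in A\}\in q\}\in p .$$ A set $A\subseteq S$ is called central near zero if $A\in p$ for some idempotent $p$ in the smallest two-sided ideal of $0^+(S)$. For $m\in\mathbb N$ let $\mathcal V_m$ be the set of $m$-tuples $H=(H(1),\dots,H(m))$ of finite nonempty subsets of $\mathbb N$ such that $\max H(t)<\min H(t+1)$ for $1\le t\le m-1$. For $k\in\mathbb N$ and $\delta>0$ let $S_\delta^{k}=S^{k}\cap(0,\delta/k)^{k}$. Let $\Phi$ be the set of functions $f:\mathbb N\to\mathbb N$ with $f(n)\le n$ for all $n$. For a sequence $(x_n)_{n\in\mathbb N}$ of real numbers let $FS((x_n)_{n\in\mathbb N})=\{\sum_{n\in K}x_n: K\subseteq\mathbb N\text{ finite and nonempty}\}$. **Theorem 3.20.** Let $S$ be a dense subsemigroup of $((0,\infty),+)$, let $A\subseteq S$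 be central near zero, and for each $l\in\mathbb N$ let $(y_{l,n})_{n\in\mathbb N}$ be a sequence in $S$ with $\lim_{n\to\infty}y_{l,n}=0$. For $l,m\in\mathbb N$, $a\in S^{m+1}$ and $H\in\mathcal V_m$ put $$w(a,H,l)=\Bigl(\sum_{i=1}^m\bigl(a(i)+\sum_{t\in H(i)}y_{l,t}\bigr)\Bigr)+a(m+1).$$ Then there exist sequences $(m(n))_{n\in\mathbb N}$, $(a_n)_{n\in\mathbb N}$ and $(H_n)_{n\in\mathbb N}$ such that 1. for each $n\in\mathbb N$: $m(n)\in\mathbb N$, $a_n\in S_{1/n}^{m(n)+1}\cap S_{1/m(n)}^{m(n)+1}$, $H_n\in\mathcal V_{m(n)}$, and $\max H_n(m(n))<\min H_{n+1}(1)$; 2. for each $f\in\Phi$, $FS\bigl((w(a_n,H_n,f(n)))_{n\in\mathbb N}\bigr)\subseteq A$. -/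

import Mathlib

open Filter Topology

/- The sum of ultrafilters: `A ∈ p + q ↔ {x | {y | x + y ∈ A} ∈ q} ∈ p`. -/
attribute [local instance] Ultrafilter.add

namespace NearZero

/-- `S` is a dense subsemigroup of `((0, ∞), +)`. -/
structure IsDenseSubsemigroup (S : AddSubsemigroup ℝ) : Prop where
  pos : ∀ x ∈ S, 0 < x
  dense : Set.Ioi (0 : ℝ) ⊆ closure (S : Set ℝ)

/-- `0⁺(S)`: the ultrafilters on (discrete) `S` that contain `(0, ε) ∩ S` for every `ε > 0`. -/
def zeroPlus (S : AddSubsemigroup ℝ) : Set (Ultrafilter S) :=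
  {p | ∀ ε : ℝ, 0 < ε → {x : S | (x : ℝ) ∈ Set.Ioo 0 ε} ∈ p}

/-- `I` is a (nonempty) two-sided ideal of the subsemigroup `T` of `X`. -/
structure IsTwoSidedIdeal {X : Type*} [Add X] (T I : Set X) : Prop where
  nonempty : I.Nonempty
  subset : I ⊆ T
  add_mem_left : ∀ t ∈ T, ∀ x ∈ I, t + x ∈ I
  add_mem_right : ∀ x ∈ I, ∀ t ∈ T, x + t ∈ I

/-- The smallest two-sided ideal `K(T)` of `T`: the elements of `T` lying in every two-sided
ideal of `T`. -/
def smallestIdeal {X : Type*} [Add X] (T : Set X) : Set X :=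
  {x | x ∈ T ∧ ∀ I : Set X, IsTwoSidedIdeal T I → x ∈ I}

/-- `A` is a central subset of `S` near zero: `A ⊆ S`, and `A` is a member of some idempotent
in the smallest ideal of `0⁺(S)`. -/
def IsCentralNearZero (S : AddSubsemigroup ℝ) (A : Set ℝ) : Prop :=
  A ⊆ (S : Set ℝ) ∧
    ∃ p ∈ smallestIdeal (zeroPlus S), p + p = p ∧ {x : S | (x : ℝ) ∈ A} ∈ p

/-- Finite nonempty sets of positive integers. -/
abbrev Pf : Type := {F : Finset ℕ+ // F.Nonempty}

/-- The maximum of a finite nonempty set. -/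
def Pf.max (F : Pf) : ℕ+ := F.1.max' F.2

/-- The minimum of a finite nonempty set. -/
def Pf.min (F : Pf) : ℕ+ := F.1.min' F.2

/-- The first index of an `m`-tuple. -/
def firstIdx (m : ℕ+) : Fin m := ⟨0, m.pos⟩

/-- The last index of an `m`-tuple. -/
def lastIdx (m : ℕ+) : Fin m := ⟨(m : ℕ) - 1, Nat.sub_lt m.pos Nat.one_pos⟩

/-- `𝒱_m`: the `m`-tuples of finite nonempty sets with each one entirely before the next. -/
def blockTuples (m : ℕ+) : Set (Fin m → Pf) :=
  {H | ∀ i j : Fin m, (i : ℕ) + 1 = j → (H i).max < (H j).min}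

/-- `S_δ^k = S^k ∩ (0, δ / k)^k`. -/
def smallTuples (S : AddSubsemigroup ℝ) (δ : ℝ) (k : ℕ) : Set (Fin k → ℝ) :=
  {a | ∀ i, a i ∈ S ∧ a i ∈ Set.Ioo 0 (δ / k)}

/-- `w(a, H, l) = (∑_{i=1}^m (a(i) + ∑_{t ∈ H(i)} y_{l,t})) + a(m+1)`. -/
def w (y : ℕ+ → ℕ+ → ℝ) {m : ℕ+} (a : Fin ((m : ℕ) + 1) → ℝ) (H : Fin m → Pf) (l : ℕ+) : ℝ :=
  (∑ i : Fin m, (a i.castSucc + ∑ t ∈ (H i).1, y l t)) + a (Fin.last m)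

/-- `Φ`: the functions `f` on the positive integers with `f n ≤ n` for all `n`. -/
def Phi : Set (ℕ+ → ℕ+) := {f | ∀ n, f n ≤ n}

/-- The set of all sums of `x` over finite nonempty sets of indices. -/
def FS (x : ℕ+ → ℝ) : Set ℝ := {s | ∃ K : Pf, s = ∑ n ∈ K.1, x n}

end NearZero

namespace NearZero

/-! J-sets near zero are partition regular, by Hales–Jewett, so some ultrafilter consists of them.
All such ultrafilters form a two-sided ideal of `0⁺(S)`, hence the given idempotent `p` of the
smallest ideal is among them. A recursion along `p` then keeps, at each stage, a member of `p` in
which all later sums must lie. Blocks of length `m(n) = 1` suffice. -/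

/-- A null sequence with values in `S ∪ {0}`. -/
def IsNullSeq (S : AddSubsemigroup ℝ) (f : ℕ+ → ℝ) : Prop :=
  (∀ t, f t = 0 ∨ f t ∈ S) ∧ Tendsto f atTop (𝓝 0)

/-- `A` is a `J`-set near zero: arbitrarily close to zero, `A` contains translates of
simultaneous late partial sums of any finitely many null sequences. -/
def IsJNearZero (S : AddSubsemigroup ℝ) (A : Set ℝ) : Prop :=
  ∀ F : Set (ℕ+ → ℝ), F.Finite → (∀ f ∈ F, IsNullSeq S f) → ∀ (r : ℕ+) (ε : ℝ), 0 < ε →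
    ∃ a ∈ S, ∃ H : Finset ℕ+, H.Nonempty ∧ (∀ t ∈ H, r < t) ∧
      ∀ f ∈ F, a + ∑ t ∈ H, f t ∈ A ∧ a + ∑ t ∈ H, f t < ε

/-- `S` with `0` adjoined. -/
def adjoinZero (S : AddSubsemigroup ℝ) : AddSubmonoid ℝ where
  carrier := {x | x = 0 ∨ x ∈ S}
  zero_mem' := Or.inl rfl
  add_mem' := by
    rintro a b (rfl | ha) (rfl | hb)
    · simp
    · right; simpa using hb
    · right; simpa using ha
    · exact Or.inr (S.add_mem ha hb)

theorem add_mem_of_mem_adjoinZero {S : AddSubsemigroup ℝ} {a b : ℝ} (ha : a ∈ S)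
    (hb : b ∈ adjoinZero S) : a + b ∈ S := by
  rcases hb with rfl | hb
  · simpa using ha
  · exact S.add_mem ha hb

theorem IsDenseSubsemigroup.exists_lt {S : AddSubsemigroup ℝ} (hS : IsDenseSubsemigroup S) {ε : ℝ}
    (hε : 0 < ε) : ∃ a ∈ S, a < ε := by
  obtain ⟨a, ha, haS⟩ := mem_closure_iff.1 (hS.dense (Set.mem_Ioi.2 (half_pos hε)))
    (Set.Ioo 0 ε) isOpen_Ioo ⟨half_pos hε, half_lt_self hε⟩
  exact ⟨a, haS, ha.2⟩

theorem sum_mem_of_nonempty {S : AddSubsemigroup ℝ} {ι : Type*} {s : Finset ι} (hs : s.Nonempty)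
    {f : ι → ℝ} (hf : ∀ i ∈ s, f i ∈ S) : ∑ i ∈ s, f i ∈ S := by
  classical
  obtain ⟨i, hi⟩ := hs
  rw [← Finset.add_sum_erase s f hi]
  exact add_mem_of_mem_adjoinZero (hf i hi)
    (AddSubmonoid.sum_mem _ fun j hj => Or.inr (hf j (Finset.mem_of_mem_erase hj)))

theorem IsJNearZero.mono {S : AddSubsemigroup ℝ} {A B : Set ℝ} (hA : IsJNearZero S A)
    (h : A ⊆ B) : IsJNearZero S B := by
  intro F hF hFS r ε hε
  obtain ⟨a, ha, H, hH, hr, h'⟩ := hA F hF hFS r ε hε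
  exact ⟨a, ha, H, hH, hr, fun f hf => ⟨h (h' f hf).1, (h' f hf).2⟩⟩

theorem isNullSeq_zero (S : AddSubsemigroup ℝ) : IsNullSeq S 0 :=
  ⟨fun _ => Or.inl rfl, tendsto_const_nhds⟩

theorem IsJNearZero.exists_mem {S : AddSubsemigroup ℝ} {A : Set ℝ} (hA : IsJNearZero S A)
    {ε : ℝ} (hε : 0 < ε) : ∃ a ∈ S, a ∈ A ∧ a < ε := by
  obtain ⟨a, ha, H, -, -, h⟩ := hA {0} (Set.finite_singleton _)
    (by rintro f rfl; exact isNullSeq_zero S) 1 ε hε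
  exact ⟨a, ha, by simpa using h 0 rfl⟩

theorem isJNearZero_self {S : AddSubsemigroup ℝ} (hS : IsDenseSubsemigroup S) :
    IsJNearZero S (S : Set ℝ) := by
  intro F hF hFS r ε hε
  obtain ⟨a, ha, haε⟩ := hS.exists_lt hε
  have h1 : ∀ᶠ t in atTop, ∀ f ∈ F, f t < ε - a :=
    (Filter.eventually_all_finite hF).2 fun f hf =>
      (hFS f hf).2.eventually (gt_mem_nhds (sub_pos.2 haε))
  obtain ⟨t, ht, hrt⟩ := (h1.and (eventually_gt_atTop r)).exists
  refine ⟨a, ha, {t}, Finset.singleton_nonempty _, by simpa using hrt, fun f hf => ?_⟩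
  rw [Finset.sum_singleton]
  exact ⟨add_mem_of_mem_adjoinZero ha ((hFS f hf).1 t), by linarith [ht f hf]⟩

/-! ### Partition regularity -/

/-- An injective coding of pairs by late positive integers. -/
def lateIndex (t : ℕ+) (j : ℕ) : ℕ+ := (Nat.pair t j).succPNat

theorem lt_lateIndex (t : ℕ+) (j : ℕ) : t < lateIndex t j := by
  rw [← PNat.coe_lt_coe]
  exact Nat.lt_succ_of_le (Nat.left_le_pair _ _)

theorem lateIndex_inj {t t' : ℕ+} {j j' : ℕ} (h : lateIndex t j = lateIndex t' j') :
    t = t' ∧ j = j' := by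
  have := Nat.pair_eq_pair.1 (Nat.succPNat_injective h)
  exact ⟨PNat.coe_injective this.1, this.2⟩

theorem tendsto_lateIndex (j : ℕ) : Tendsto (lateIndex · j) atTop atTop :=
  tendsto_atTop_mono (fun t => (lt_lateIndex t j).le) tendsto_id

/-- The sequence interleaving the letters of a word `v` of sequences. -/
def interleave {ι : Type} [Fintype ι] (e : ι → ℕ) (v : ι → ℕ+ → ℝ) (t : ℕ+) : ℝ :=
  ∑ i, v i (lateIndex t (e i))

theorem isNullSeq_interleave {S : AddSubsemigroup ℝ} {ι : Type} [Fintype ι] (e : ι → ℕ)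
    {v : ι → ℕ+ → ℝ} (hv : ∀ i, IsNullSeq S (v i)) : IsNullSeq S (interleave e v) := by
  refine ⟨fun t => AddSubmonoid.sum_mem (adjoinZero S) fun i _ => (hv i).1 _, ?_⟩
  have := tendsto_finsetSum (Finset.univ : Finset ι)
    fun i _ => (hv i).2.comp (tendsto_lateIndex (e i))
  rwa [Finset.sum_const_zero] at this

/-- A combinatorial line of words of sequences turns a translated sum of interleavings into
translated sums of the letters themselves. -/
theorem exists_sum_eq_of_line {S : AddSubsemigroup ℝ} {ι : Type} [Fintype ι] {e : ι → ℕ}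
    (he : Function.Injective e) {F : Set (ℕ+ → ℝ)} (hFS : ∀ f ∈ F, IsNullSeq S f)
    (l : Combinatorics.Line F ι) {a : ℝ} (ha : a ∈ S) {H : Finset ℕ+} (hH : H.Nonempty)
    {r : ℕ+} (hr : ∀ t ∈ H, r < t) :
    ∃ a' ∈ S, ∃ H' : Finset ℕ+, H'.Nonempty ∧ (∀ t ∈ H', r < t) ∧
      ∀ f : F, a' + ∑ t ∈ H', f.1 t = a + ∑ t ∈ H, interleave e (fun i => (l f i).1) t := by
  classical
  -- The fixed letters of the line go into the translation; the active coordinates `V` supply the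
  -- indices of `H'`.
  let c : ι → ℕ+ → ℝ := fun i => (l.idxFun i).elim 0 Subtype.val
  have hc : ∀ i t, c i t ∈ adjoinZero S := by
    intro i t
    rcases h : l.idxFun i with _ | g
    · simp [c, h, zero_mem]
    · simp only [c, h]
      exact (hFS g g.2).1 t
  let V : Finset ι := Finset.univ.filter fun i => l.idxFun i = none
  have hV : V.Nonempty := by
    obtain ⟨i, hi⟩ := l.proper
    exact ⟨i, by simp [V, hi]⟩
  have hlate : Function.Injective fun x : ℕ+ × ι => lateIndex x.1 (e x.2) := by
    rintro ⟨t, i⟩ ⟨t', i'⟩ h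
    obtain ⟨h1, h2⟩ := lateIndex_inj h
    exact Prod.ext h1 (he h2)
  refine ⟨a + ∑ t ∈ H, ∑ i, c i (lateIndex t (e i)), add_mem_of_mem_adjoinZero ha
    (AddSubmonoid.sum_mem _ fun t _ => AddSubmonoid.sum_mem _ fun i _ => hc _ _),
    (H ×ˢ V).image fun x => lateIndex x.1 (e x.2), (hH.product hV).image _, ?_, ?_⟩
  · intro t ht
    obtain ⟨x, hx, rfl⟩ := Finset.mem_image.1 ht
    exact (hr _ (Finset.mem_product.1 hx).1).trans (lt_lateIndex _ _)
  · intro f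
    rw [Finset.sum_image hlate.injOn, Finset.sum_product, add_assoc, ← Finset.sum_add_distrib]
    congr 1
    refine Finset.sum_congr rfl fun t _ => ?_
    rw [interleave, Finset.sum_filter, ← Finset.sum_add_distrib]
    refine Finset.sum_congr rfl fun i _ => ?_
    rcases h : l.idxFun i with _ | g
    · simp [c, h]
    · simp [c, h]

/-- `J`-sets near zero are partition regular. -/
theorem IsJNearZero.of_union {S : AddSubsemigroup ℝ} {A B : Set ℝ}
    (hAB : IsJNearZero S (A ∪ B)) : IsJNearZero S A ∨ IsJNearZero S B := by
  by_contra! hcon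
  obtain ⟨hA, hB⟩ := hcon
  unfold IsJNearZero at hA hB
  push Not at hA hB
  obtain ⟨F₁, hF₁, hFS₁, r₁, ε₁, hε₁, hA⟩ := hA
  obtain ⟨F₂, hF₂, hFS₂, r₂, ε₂, hε₂, hB⟩ := hB
  have hFS : ∀ f ∈ F₁ ∪ F₂, IsNullSeq S f := by
    rintro f (hf | hf)
    exacts [hFS₁ f hf, hFS₂ f hf]
  have : Finite ↥(F₁ ∪ F₂) := (hF₁.union hF₂).to_subtype
  obtain ⟨ι, _, hι⟩ := Combinatorics.Line.exists_mono_in_high_dimension ↥(F₁ ∪ F₂) Prop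
  let e : ι → ℕ := fun i => Fintype.equivFin ι i
  have he : Function.Injective e := Fin.val_injective.comp (Fintype.equivFin ι).injective
  -- One translation and one index set serve all words at once; words are then coloured by whether
  -- their sum lies in `A`.
  obtain ⟨a, ha, H, hH, hr, h⟩ := hAB
    (Set.range fun v : ι → ↥(F₁ ∪ F₂) => interleave e fun i => (v i).1) (Set.finite_range _)
    (by rintro _ ⟨v, rfl⟩; exact isNullSeq_interleave e fun i => hFS _ (v i).2)
    (max r₁ r₂) (min ε₁ ε₂) (lt_min hε₁ hε₂)
  obtain ⟨l, c, hl⟩ := hι fun v => a + ∑ t ∈ H, interleave e (fun i => (v i).1) t ∈ A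
  obtain ⟨a', ha', H', hH', hr', h'⟩ := exists_sum_eq_of_line he hFS l ha hH hr
  by_cases hc : c
  · obtain ⟨f, hf, hfA⟩ := hA a' ha' H' hH' fun t ht => (le_max_left _ _).trans_lt (hr' t ht)
    have hf' := h' ⟨f, Or.inl hf⟩
    have h1 := h _ ⟨l ⟨f, Or.inl hf⟩, rfl⟩
    have h2 := (hl ⟨f, Or.inl hf⟩).mpr hc
    rw [← hf'] at h1 h2
    exact absurd (h1.2.trans_le (min_le_left _ _)) (hfA h2).not_gt
  · obtain ⟨f, hf, hfB⟩ := hB a' ha' H' hH' fun t ht => (le_max_right _ _).trans_lt (hr' t ht)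
    have hf' := h' ⟨f, Or.inr hf⟩
    have h1 := h _ ⟨l ⟨f, Or.inr hf⟩, rfl⟩
    have h2 := fun h => hc ((hl ⟨f, Or.inr hf⟩).mp h)
    beta_reduce at h1 h2
    rw [← hf'] at h1 h2
    exact absurd (h1.2.trans_le (min_le_right _ _)) (hfB (h1.1.resolve_left h2)).not_gt

/-! ### The ideal of J-ultrafilters -/

/-- The ultrafilters on `S` all of whose members are `J`-sets near zero. -/
def jUltrafilters (S : AddSubsemigroup ℝ) : Set (Ultrafilter S) :=
  {p | ∀ A : Set ℝ, (∀ᶠ x : S in p, (x : ℝ) ∈ A) → IsJNearZero S A}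

theorem jUltrafilters_nonempty {S : AddSubsemigroup ℝ} (hS : IsDenseSubsemigroup S) :
    (jUltrafilters S).Nonempty := by
  -- By partition regularity the non-J-sets form an ideal of sets; an ultrafilter refining the dual
  -- filter contains only J-sets.
  let G : Filter ℝ := Filter.comk (fun A => ¬ IsJNearZero S A)
    (fun h => by obtain ⟨a, -, ha, -⟩ := h.exists_mem one_pos; exact ha)
    (fun A hA B hBA hB => hA (hB.mono hBA))
    (fun A hA B hB hAB => hAB.of_union.elim hA hB)
  have hG : G.NeBot := by
    refine ⟨fun h => ?_⟩
    have h0 : (∅ : Set ℝ) ∈ G := by rw [h]; trivial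
    rw [Filter.mem_comk, Set.compl_empty] at h0
    exact h0 ((isJNearZero_self hS).mono (Set.subset_univ _))
  have hJ : ∀ A ∈ Ultrafilter.of G, IsJNearZero S A := by
    intro A hA
    by_contra hn
    have : Aᶜ ∈ G := by rwa [Filter.mem_comk, compl_compl]
    exact Ultrafilter.compl_notMem_iff.2 hA (Ultrafilter.of_le G this)
  have hrange : Set.range (Subtype.val : S → ℝ) ∈ Ultrafilter.of G := by
    by_contra hn
    obtain ⟨a, ha, ha', -⟩ := (hJ _ (Ultrafilter.compl_mem_iff_notMem.2 hn)).exists_mem one_pos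
    exact ha' ⟨⟨a, ha⟩, rfl⟩
  refine ⟨(Ultrafilter.of G).comap Subtype.val_injective hrange, fun A hA => ?_⟩
  have hA' : Subtype.val ⁻¹' A ∈ (Ultrafilter.of G).comap Subtype.val_injective hrange := hA
  rw [Ultrafilter.mem_comap] at hA'
  exact (hJ _ hA').mono (Set.image_preimage_subset _ _)

theorem isTwoSidedIdeal_jUltrafilters {S : AddSubsemigroup ℝ} (hS : IsDenseSubsemigroup S) :
    IsTwoSidedIdeal (zeroPlus S) (jUltrafilters S) where
  nonempty := jUltrafilters_nonempty hS
  subset := by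
    intro p hp ε hε
    by_contra hn
    obtain ⟨a, ha, haA, haε⟩ := (hp (Set.Ioo 0 ε)ᶜ
      (Ultrafilter.compl_mem_iff_notMem.2 hn)).exists_mem hε
    exact haA ⟨hS.pos a ha, haε⟩
  add_mem_left := by
    intro q hq p hp A hA F hF hFS r ε hε
    rw [Ultrafilter.eventually_add] at hA
    have hq' : ∀ᶠ x : S in q, (x : ℝ) ∈ Set.Ioo 0 (ε / 2) := hq _ (half_pos hε)
    obtain ⟨x, hx, hxε⟩ := (hA.and hq').exists
    obtain ⟨a, ha, H, hH, hr, h⟩ := hp {z | (x : ℝ) + z ∈ A} hx F hF hFS r _ (half_pos hε)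
    refine ⟨x + a, S.add_mem x.2 ha, H, hH, hr, fun f hf => ?_⟩
    rw [add_assoc]
    exact ⟨(h f hf).1, by linarith [(h f hf).2, hxε.2]⟩
  add_mem_right := by
    intro p hp q hq A hA F hF hFS r ε hε
    rw [Ultrafilter.eventually_add] at hA
    have hq' : ∀ᶠ x : S in q, (x : ℝ) ∈ Set.Ioo 0 (ε / 2) := hq _ (half_pos hε)
    obtain ⟨a, ha, H, hH, hr, h⟩ := hp {x | ∀ᶠ z : S in q, x + (z : ℝ) ∈ A} hA F hF hFS r _
      (half_pos hε)
    -- As `F` is finite, a single small `z` works for every `f`, and the translation absorbs it.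
    obtain ⟨z, hz, hzε⟩ :=
      (((Filter.eventually_all_finite hF).2 fun f hf => (h f hf).1).and hq').exists
    refine ⟨a + z, S.add_mem ha z.2, H, hH, hr, fun f hf => ?_⟩
    rw [add_right_comm]
    exact ⟨hz f hf, by linarith [(h f hf).2, hzε.2]⟩

/-! ### Recursion along the idempotent -/

/-- The value of `w` at a block tuple of length one. -/
def wOne (y : ℕ+ → ℕ+ → ℝ) (b c : ℝ) (H : Pf) (l : ℕ+) : ℝ :=
  b + ∑ t ∈ H.1, y l t + c

theorem w_one (y : ℕ+ → ℕ+ → ℝ) (b c : ℝ) (H : Pf) (l : ℕ+) :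
    w (m := 1) y (![b, c] : Fin 2 → ℝ) (fun _ => H) l = wOne y b c H l := by
  change (∑ i : Fin 1, ((![b, c] : Fin 2 → ℝ) i.castSucc + ∑ t ∈ H.1, y l t)) + c = _
  rw [Fin.sum_univ_one]
  rfl

/-- A J-set gives only one translation. Using the sequences `y l + y 1` makes the sum of `y 1` over
the block the second one; the case `l = 1` bounds both. -/
theorem IsJNearZero.exists_wOne_mem {S : AddSubsemigroup ℝ} (hS : IsDenseSubsemigroup S)
    {y : ℕ+ → ℕ+ → ℝ} (hyS : ∀ l n, y l n ∈ S) (hy : ∀ l, Tendsto (y l) atTop (𝓝 0))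
    {A : Set ℝ} (hA : IsJNearZero S A) (n r : ℕ+) {ε : ℝ} (hε : 0 < ε) :
    ∃ b ∈ S, ∃ c ∈ S, b < ε ∧ c < ε ∧ ∃ H : Pf, r < H.min ∧ ∀ l ≤ n, wOne y b c H l ∈ A := by
  obtain ⟨b, hb, H, hH, hr, h⟩ := hA ((fun l t => y l t + y 1 t) '' Set.Iic n)
    ((Set.finite_Iic n).image _)
    (by
      rintro _ ⟨l, -, rfl⟩
      exact ⟨fun t => Or.inr (S.add_mem (hyS _ _) (hyS _ _)), by simpa using (hy l).add (hy 1)⟩)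
    r ε hε
  have hc : ∑ t ∈ H, y 1 t ∈ S := sum_mem_of_nonempty hH fun t _ => hyS 1 t
  have h1 := (h _ ⟨1, Set.mem_Iic.2 one_le, rfl⟩).2
  rw [Finset.sum_add_distrib] at h1
  have hb0 := hS.pos _ hb
  have hc0 := hS.pos _ hc
  refine ⟨b, hb, _, hc, by linarith, by linarith, ⟨H, hH⟩, hr _ (H.min'_mem hH), fun l hl => ?_⟩
  have h2 := (h _ ⟨l, hl, rfl⟩).1
  rwa [Finset.sum_add_distrib, ← add_assoc] at h2

/-- A stage of the recursive construction: the next element and the set in which all later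
sums have to lie. -/
structure Stage (S : AddSubsemigroup ℝ) (p : Ultrafilter S) where
  /-- The set that contains all later sums. -/
  target : Set ℝ
  target_mem : ∀ᶠ x : S in p, (x : ℝ) ∈ target
  /-- The first translation. -/
  fst : ℝ
  /-- The second translation. -/
  snd : ℝ
  /-- The index block. -/
  block : Pf

/-- The relation between the stage before the positive integer `n` and stage `n`. -/
structure Stage.Next {S : AddSubsemigroup ℝ} {p : Ultrafilter S} (y : ℕ+ → ℕ+ → ℝ) (n : ℕ+)
    (s s' : Stage S p) : Prop where
  fst_mem : s'.fst ∈ S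
  snd_mem : s'.snd ∈ S
  fst_lt : s'.fst < 1 / (2 * n)
  snd_lt : s'.snd < 1 / (2 * n)
  block_lt : s.block.max < s'.block.min
  subset : s'.target ⊆ s.target
  wOne_mem : ∀ l ≤ n, wOne y s'.fst s'.snd s'.block l ∈ s.target
  wOne_add_mem : ∀ l ≤ n, ∀ x ∈ s'.target, wOne y s'.fst s'.snd s'.block l + x ∈ s.target

theorem Stage.exists_next {S : AddSubsemigroup ℝ} (hS : IsDenseSubsemigroup S)
    {y : ℕ+ → ℕ+ → ℝ} (hyS : ∀ l n, y l n ∈ S) (hy : ∀ l, Tendsto (y l) atTop (𝓝 0))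
    {p : Ultrafilter S} (hp : p ∈ jUltrafilters S) (hpp : p + p = p) (n : ℕ+) (s : Stage S p) :
    ∃ s' : Stage S p, s.Next y n s' := by
  have h1 : ∀ᶠ x : S in p, ∀ᶠ z : S in p, (x : ℝ) + z ∈ s.target := by
    have := Ultrafilter.eventually_add p p fun x : S => (x : ℝ) ∈ s.target
    rw [hpp] at this
    exact this.1 s.target_mem
  have hn : (0 : ℝ) < 1 / (2 * n) := by
    have : (0 : ℝ) < n := by exact_mod_cast n.pos
    positivity
  -- Since `p + p = p`, the points of the target whose translate of it back is again in `p` form a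
  -- member of `p`, hence a J-set.
  obtain ⟨b, hb, c, hc, hbε, hcε, H, hH, hw⟩ := (hp
    {x | x ∈ s.target ∧ ∀ᶠ z : S in p, x + (z : ℝ) ∈ s.target}
    (s.target_mem.and h1)).exists_wOne_mem hS hyS hy n s.block.max hn
  refine ⟨⟨s.target ∩ {x | ∀ l ∈ Set.Iic n, wOne y b c H l + x ∈ s.target},
    s.target_mem.and ((Filter.eventually_all_finite (Set.finite_Iic n)).2 fun l hl =>
      (hw l hl).2), b, c, H⟩, hb, hc, hbε, hcε, hH, Set.inter_subset_left,
    fun l hl => (hw l hl).1, fun l hl x hx => hx.2 l hl⟩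

theorem exists_nat_seq_of_forall_exists {α : Type*} (R : ℕ → α → α → Prop)
    (h : ∀ n x, ∃ x', R n x x') (x₀ : α) :
    ∃ s : ℕ → α, s 0 = x₀ ∧ ∀ n, R n (s n) (s (n + 1)) := by
  choose g hg using h
  exact ⟨fun n => Nat.rec x₀ g n, rfl, fun n => hg n _⟩

/-- Induction peels off the smallest index: the rest of the sum lies in that index's own target,
which was chosen to allow adding its term. -/
theorem sum_wOne_mem {S : AddSubsemigroup ℝ} {p : Ultrafilter S} {y : ℕ+ → ℕ+ → ℝ}
    {s : ℕ → Stage S p} (hs : ∀ n, (s n).Next y n.succPNat (s (n + 1))) {f : ℕ+ → ℕ+}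
    (hf : f ∈ Phi) (K : Finset ℕ+) :
    K.Nonempty → ∀ N : ℕ, (∀ n ∈ K, N < (n : ℕ)) →
      ∑ n ∈ K, wOne y (s n).fst (s n).snd (s n).block (f n) ∈ (s N).target := by
  have hanti : Antitone fun n => (s n).target := antitone_nat_of_succ_le fun n => (hs n).subset
  induction K using Finset.induction_on_min with
  | empty => exact fun h => absurd h Finset.not_nonempty_empty
  | insert n K hnK ih =>
    intro _ N hN
    obtain ⟨k, rfl⟩ : ∃ k : ℕ, n = k.succPNat := ⟨n.natPred, (PNat.succPNat_natPred n).symm⟩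
    have hNk : N ≤ k := Nat.lt_succ_iff.1 (hN _ (Finset.mem_insert_self _ _))
    refine hanti hNk ?_
    rw [Finset.sum_insert fun h => (hnK _ h).false]
    rcases K.eq_empty_or_nonempty with rfl | hK
    · rw [Finset.sum_empty, add_zero]
      exact (hs k).wOne_mem _ (hf _)
    · exact (hs k).wOne_add_mem _ (hf _) _ (ih hK (k + 1) fun m hm => hnK m hm)

theorem mem_smallTuples_pair {S : AddSubsemigroup ℝ} (hS : IsDenseSubsemigroup S) {b c δ : ℝ}
    (hb : b ∈ S) (hc : c ∈ S) (hbδ : b < δ / 2) (hcδ : c < δ / 2) :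
    (![b, c] : Fin 2 → ℝ) ∈ smallTuples S δ 2 := by
  intro i
  fin_cases i
  · exact ⟨hb, hS.pos b hb, by simpa using hbδ⟩
  · exact ⟨hc, hS.pos c hc, by simpa using hcδ⟩

end NearZero

theorem theorem3p20 (S : AddSubsemigroup ℝ) (hS : NearZero.IsDenseSubsemigroup S)
    (A : Set ℝ) (hA : NearZero.IsCentralNearZero S A)
    (y : ℕ+ → ℕ+ → ℝ) (hyS : ∀ l n, y l n ∈ S)
    (hy : ∀ l, Filter.Tendsto (y l) Filter.atTop (nhds 0)) :
    ∃ (m : ℕ+ → ℕ+) (a : ∀ n : ℕ+, Fin ((m n : ℕ) + 1) → ℝ)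
      (H : ∀ n : ℕ+, Fin (m n) → NearZero.Pf),
      (∀ n : ℕ+,
        a n ∈ NearZero.smallTuples S (1 / (n : ℝ)) ((m n : ℕ) + 1) ∧
        a n ∈ NearZero.smallTuples S (1 / (m n : ℝ)) ((m n : ℕ) + 1) ∧
        H n ∈ NearZero.blockTuples (m n) ∧
        (H n (NearZero.lastIdx (m n))).max
          < (H (n + 1) (NearZero.firstIdx (m (n + 1)))).min) ∧
      ∀ f ∈ NearZero.Phi,
        NearZero.FS (fun n => NearZero.w y (a n) (H n) (f n)) ⊆ A := by
  obtain ⟨-, p, hpK, hpp, hpA⟩ := hA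
  have hpJ := hpK.2 _ (NearZero.isTwoSidedIdeal_jUltrafilters hS)
  obtain ⟨s, hs0, hs⟩ := NearZero.exists_nat_seq_of_forall_exists
    (fun n => NearZero.Stage.Next y n.succPNat)
    (fun n => NearZero.Stage.exists_next hS hyS hy hpJ hpp n.succPNat)
    -- Only the target `A` matters at stage 0; the translations and the block `{1}` are placeholders
    -- that enter no sum.
    ⟨A, hpA, 0, 0, ⟨{1}, Finset.singleton_nonempty _⟩⟩
  refine ⟨fun _ => 1, fun n => (![(s n).fst, (s n).snd] : Fin 2 → ℝ), fun n _ => (s n).block,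
    fun n => ⟨?_, ?_, ?_, ?_⟩, ?_⟩
  · obtain ⟨k, rfl⟩ : ∃ k : ℕ, n = k.succPNat := ⟨n.natPred, (PNat.succPNat_natPred n).symm⟩
    have h := hs k
    have e : (1 : ℝ) / ((k.succPNat : ℕ+) : ℝ) / 2 = 1 / (2 * (k.succPNat : ℕ+)) := by
      rw [div_div, mul_comm]
    exact NearZero.mem_smallTuples_pair hS h.fst_mem h.snd_mem (e ▸ h.fst_lt) (e ▸ h.snd_lt)
  · obtain ⟨k, rfl⟩ : ∃ k : ℕ, n = k.succPNat := ⟨n.natPred, (PNat.succPNat_natPred n).symm⟩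
    have h := hs k
    have e : (1 : ℝ) / (2 * ((k.succPNat : ℕ+) : ℝ)) ≤ 1 / ((1 : ℕ+) : ℝ) / 2 := by
      have : (1 : ℝ) ≤ ((k.succPNat : ℕ+) : ℝ) := by exact_mod_cast k.succPNat.pos
      rw [PNat.one_coe, Nat.cast_one, div_div]
      exact one_div_le_one_div_of_le (by norm_num) (by linarith)
    exact NearZero.mem_smallTuples_pair hS h.fst_mem h.snd_mem (h.fst_lt.trans_le e) (h.snd_lt.trans_le e)
  · intro i j hij
    have := i.2
    have hj := j.2
    simp only [PNat.one_coe] at this hj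
    omega
  · exact (hs n).block_lt
  · rintro f hf _ ⟨K, rfl⟩
    simp only [NearZero.w_one]
    have := NearZero.sum_wOne_mem hs hf K.1 K.2 0 fun n _ => n.pos
    rwa [hs0] at this
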